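/- For real or complex $a$ and $0<q<1$ write $(a;q)_\infty=\lim_{N\to\infty}\prod_{i=0}^{N-1}(1-aq^i)$. Let $0<p<q<1$ be real and let $n>1$ be an integer. Then \[ (a)\quad \frac{(p;p)_{\infty}^n}{(p^{1/n};p^{1/n})_{\infty}}\,(1-p)^{\frac{n-1}{2}} \;\leq\; \frac{(q;q)_{\infty}^n}{(q^{1/n};q^{1/n})_{\infty}}\,(1-q)^{\frac{n-1}{2}} \;\leq\; \frac{(2\pi)^{\frac{n-1}{2}}}{\sqrt{n}}, \] \[ (b)\quad \frac{(p;p)_{\infty}^n}{(p;p^{1/n})_{\infty}}\,\frac{1}{(1-p)^{\frac{n-1}{2}}} \;\geq\; \frac{(q;q)_{\infty}^n}{(q;q^{1/n})_{\infty}}\,\frac{1}{(1-q)^{\frac{n-1}{2}}} \;\geq\; \frac{(n-1)!\,(2\pi)^{\frac{n-1}{2}}}{n^{\,n-\frac12}}. \] -/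

import Mathlib

open Filter Topology

/-- The finite `q`-shifted factorial `(a; q)_n = ∏_{i=0}^{n-1} (1 - a q^i)`. -/
def qShifted {R : Type*} [CommRing R] (a q : R) (n : ℕ) : R :=
  ∏ i ∈ Finset.range n, (1 - a * q ^ i)

/-- The infinite `q`-shifted factorial `(a; q)_∞ = lim_{n → ∞} (a; q)_n`. -/
noncomputable def qShiftedInf {R : Type*} [CommRing R] [TopologicalSpace R] (a q : R) : R :=
  limUnder atTop (fun n : ℕ => qShifted a q n)

/-- For `‖q‖ < 1` the limit defining `(a; q)_∞` exists, so `qShiftedInf` is its value. -/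
theorem tendsto_qShifted {𝕜 : Type*} [RCLike 𝕜] (a q : 𝕜) (hq : ‖q‖ < 1) :
    Tendsto (fun n : ℕ => qShifted a q n) atTop (𝓝 (qShiftedInf a q)) := by
  have hs : Summable (fun i : ℕ => ‖-(a * q ^ i)‖) := by
    simp only [norm_neg, norm_mul, norm_pow]
    exact (summable_geometric_of_lt_one (norm_nonneg q) hq).mul_left _
  have h := (multipliable_one_add_of_summable hs).hasProd.tendsto_prod_nat
  refine tendsto_nhds_limUnder ⟨_, h.congr fun n => ?_⟩
  simp only [qShifted, sub_eq_add_neg]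

/-! Sorting factors by exponent modulo `n` turns the two expressions into the products of `Γ_q(k/n)`
and of `Γ_q(1 + k/n)` over `1 ≤ k ≤ n - 1`. So it suffices that, for `0 < x ≤ 1`, `Γ_q(x)` increases
in `q` and is at most `Γ(x)`, while `Γ_q(1 + x)` decreases and is at least `Γ(1 + x) = x Γ(x)`.
Gauss's multiplication formula evaluates the bounds.

Both monotonicities are proved on Euler-type finite products of `q`-numbers `[s]`, which make sense
at `q = 1` too. Passing from `N` to `N + 1` multiplies or divides by `[s]^w [t]^(1-w) / [ws +
(1-w)t]`. This is antitone in `q` on `(0, 1]` because `v / (e^v - 1)` is convex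
(`antitoneOn_qBracket_interp`). Letting `N → ∞` gives every inequality, with no need for the limit
of `Γ_q` as `q → 1`. -/

/-! ### Gauss's multiplication formula at `1 / n` -/

open Finset in
theorem prod_two_mul_sin_pi_mul_div (m : ℕ) :
    ∏ k ∈ range m, (2 * Real.sin (Real.pi * (((k : ℝ) + 1) / (m + 1)))) = m + 1 := by
  have hμ := Complex.isPrimitiveRoot_exp (m + 1) m.succ_ne_zero
  -- Over the nontrivial roots of unity `ζ^(k+1)` of order dividing `m + 1`, the product of `1 -
  -- ζ^(k+1)` is `m + 1`; the moduli of its factors are the sines.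
  have h := congrArg (fun z : ℂ => ‖z‖) hμ.prod_one_sub_pow_eq_order
  simp only [norm_prod] at h
  have hr : ‖(m : ℂ) + 1‖ = (m : ℝ) + 1 := by
    have : ((m : ℂ) + 1) = ((m + 1 : ℕ) : ℂ) := by push_cast; ring
    rw [this, Complex.norm_natCast]; push_cast; ring
  rw [hr] at h
  refine Eq.trans (prod_congr rfl fun k hk => ?_) h
  have hk' : k < m := mem_range.1 hk
  have hm : (0 : ℝ) < m + 1 := by positivity
  have hkm : (k : ℝ) + 1 ≤ m := by exact_mod_cast hk'
  have hexp : Complex.exp (2 * Real.pi * Complex.I / ((m + 1 : ℕ) : ℂ)) ^ (k + 1)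
      = Complex.exp (Complex.I * ((2 * Real.pi * (((k : ℝ) + 1) / (m + 1)) : ℝ) : ℂ)) := by
    rw [← Complex.exp_nat_mul]
    congr 1
    push_cast
    ring
  rw [hexp, norm_sub_rev, Complex.norm_exp_I_mul_ofReal_sub_one, Real.norm_eq_abs, abs_of_nonneg]
  · congr 2; ring
  · have h1 : ((k : ℝ) + 1) / (m + 1) ≤ 1 := by rw [div_le_one hm]; linarith
    have h0 : 0 ≤ ((k : ℝ) + 1) / (m + 1) := by positivity
    have := Real.sin_nonneg_of_nonneg_of_le_pi (x := 2 * Real.pi * (((k : ℝ) + 1) / (m + 1)) / 2)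
      (by positivity) (by nlinarith [Real.pi_pos])
    positivity

open Finset in
/-- The special case `x = 1 / n` of Gauss's multiplication formula. -/
theorem prod_Gamma_div_eq (m : ℕ) :
    ∏ k ∈ range m, Real.Gamma (((k : ℝ) + 1) / (m + 1))
      = (2 * Real.pi) ^ ((m : ℝ) / 2) / Real.sqrt (m + 1) := by
  have hm : (0 : ℝ) < m + 1 := by positivity
  have hpos : 0 ≤ ∏ k ∈ range m, Real.Gamma (((k : ℝ) + 1) / (m + 1)) :=
    prod_nonneg fun k _ => (Real.Gamma_pos_of_pos (by positivity)).le
  have hsq : (∏ k ∈ range m, Real.Gamma (((k : ℝ) + 1) / (m + 1))) ^ 2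
      = (2 * Real.pi) ^ m / (m + 1) := by
    rw [sq]
    -- Reversing one copy pairs `Γ(x)` with `Γ(1 - x)`, so the reflection formula applies.
    nth_rewrite 2 [← prod_range_reflect]
    rw [← prod_mul_distrib, eq_div_iff hm.ne']
    refine (congrArg (_ * ·) (prod_two_mul_sin_pi_mul_div m).symm).trans ?_
    simp only [← prod_mul_distrib]
    have : (2 * Real.pi) ^ m = ∏ k ∈ range m, (2 * Real.pi) := by simp
    rw [this]
    refine prod_congr rfl fun k hk => ?_
    have hk' : k < m := mem_range.1 hk
    have hkm : (k : ℝ) + 1 ≤ m := by exact_mod_cast hk'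
    have hc : (((m - 1 - k : ℕ) : ℝ) + 1) / (m + 1) = 1 - ((k : ℝ) + 1) / (m + 1) := by
      have : m - 1 - k + 1 + k = m := by omega
      have h2 : ((m - 1 - k : ℕ) : ℝ) + 1 + k = m := by exact_mod_cast this
      field_simp
      linarith
    rw [hc, Real.Gamma_mul_Gamma_one_sub]
    have hs : 0 < Real.sin (Real.pi * (((k : ℝ) + 1) / (m + 1))) := by
      apply Real.sin_pos_of_pos_of_lt_pi (by positivity)
      have : ((k : ℝ) + 1) / (m + 1) < 1 := by rw [div_lt_one hm]; linarith
      nlinarith [Real.pi_pos]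
    rw [mul_left_comm, div_mul_cancel₀ _ hs.ne']
  rw [← Real.sqrt_sq hpos, hsq, Real.sqrt_div (by positivity), Real.sqrt_eq_rpow,
    ← Real.rpow_natCast, ← Real.rpow_mul (by positivity)]
  congr 2
  ring

/-! ### Splitting and positivity of infinite products -/

theorem qShifted_mul_right {R : Type*} [CommRing R] (a r : R) (n N : ℕ) :
    qShifted a r (n * N) = ∏ k ∈ Finset.range n, qShifted (a * r ^ k) (r ^ n) N := by
  unfold qShifted
  rw [Finset.prod_comm]
  induction N with
  | zero => simp
  | succ N ih =>
    rw [Nat.mul_succ, Finset.prod_range_add, ih, Finset.prod_range_succ]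
    congr 1
    refine Finset.prod_congr rfl fun k _ => ?_
    ring

theorem qShiftedInf_eq_prod {𝕜 : Type*} [RCLike 𝕜] (a r : 𝕜) (hr : ‖r‖ < 1) {n : ℕ} (hn : n ≠ 0) :
    qShiftedInf a r = ∏ k ∈ Finset.range n, qShiftedInf (a * r ^ k) (r ^ n) := by
  have h1 : Tendsto (fun N : ℕ => qShifted a r (n * N)) atTop (𝓝 (qShiftedInf a r)) :=
    (tendsto_qShifted a r hr).comp (tendsto_id.const_mul_atTop' (Nat.pos_of_ne_zero hn))
  have hrn : ‖r ^ n‖ < 1 := by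
    rw [norm_pow]; exact pow_lt_one₀ (norm_nonneg _) hr hn
  refine tendsto_nhds_unique h1 ?_
  simp only [qShifted_mul_right]
  exact tendsto_finsetProd _ fun k _ => tendsto_qShifted _ _ hrn

theorem qShiftedInf_pos {a q : ℝ} (ha0 : 0 ≤ a) (ha : a < 1) (hq0 : 0 ≤ q) (hq : q < 1) :
    0 < qShiftedInf a q := by
  have hqn : ‖q‖ < 1 := by rwa [Real.norm_of_nonneg hq0]
  have hf : ∀ i : ℕ, 0 < 1 + -(a * q ^ i) := fun i => by
    have : q ^ i ≤ 1 := pow_le_one₀ hq0 hq.le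
    have : a * q ^ i ≤ a * 1 := by gcongr
    linarith
  have hs : Summable (fun i : ℕ => ‖-(a * q ^ i)‖) := by
    simp only [norm_neg, norm_mul, norm_pow]
    exact (summable_geometric_of_lt_one (norm_nonneg q) hqn).mul_left _
  have h := (multipliable_one_add_of_summable hs).hasProd.tendsto_prod_nat
  have heq : qShiftedInf a q = ∏' i : ℕ, (1 + -(a * q ^ i)) := by
    refine tendsto_nhds_unique (tendsto_qShifted a q hqn) (h.congr fun n => ?_)
    simp only [qShifted, sub_eq_add_neg]
  -- Positive partial products only give a nonnegative limit; summability excludes zero.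
  have hne : qShiftedInf a q ≠ 0 := by
    rw [heq]; exact tprod_one_add_ne_zero_of_summable (fun i => (hf i).ne') hs
  refine lt_of_le_of_ne ?_ hne.symm
  refine ge_of_tendsto' (tendsto_qShifted a q hqn) fun n => ?_
  exact Finset.prod_nonneg fun i _ => by have := hf i; linarith

/-! ### Convexity and interpolation of `q`-numbers -/

theorem convexOn_div_exp_sub_one :
    ConvexOn ℝ (Set.Ioi 0) (fun v : ℝ => v / (Real.exp v - 1)) := by
  have hne : ∀ v : ℝ, 0 < v → 0 < Real.exp v - 1 := fun v hv => by
    have := Real.add_one_lt_exp hv.ne'; linarith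
  have h1 : ∀ v : ℝ, 0 < v → HasDerivAt (fun v : ℝ => v / (Real.exp v - 1))
      ((Real.exp v - 1 - v * Real.exp v) / (Real.exp v - 1) ^ 2) v := fun v hv => by
    convert! (hasDerivAt_id v).div ((Real.hasDerivAt_exp v).sub_const 1) (hne v hv).ne' using 1
    simp
  have h2 : ∀ v : ℝ, 0 < v → HasDerivAt
      (fun v : ℝ => (Real.exp v - 1 - v * Real.exp v) / (Real.exp v - 1) ^ 2)
      (Real.exp v * (v * (Real.exp v + 1) - 2 * (Real.exp v - 1)) / (Real.exp v - 1) ^ 3) v :=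
    fun v hv => by
    have hd := hne v hv
    convert! (((Real.hasDerivAt_exp v).sub_const 1).sub
      ((hasDerivAt_id v).mul (Real.hasDerivAt_exp v))).div
      (((Real.hasDerivAt_exp v).sub_const 1).pow 2) (pow_pos hd 2).ne' using 1
    simp only [id, Pi.sub_apply, Pi.mul_apply, Pi.pow_apply]
    field_simp
    ring
  -- This factor of the second derivative vanishes at `0`, and its own derivative is nonnegative
  -- since `1 - v ≤ e^(-v)`.
  have h3 : ∀ v : ℝ, 0 ≤ v → 0 ≤ v * (Real.exp v + 1) - 2 * (Real.exp v - 1) := by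
    have hmono : MonotoneOn (fun v : ℝ => v * (Real.exp v + 1) - 2 * (Real.exp v - 1))
        (Set.Ici 0) := by
      refine monotoneOn_of_hasDerivWithinAt_nonneg (convex_Ici 0) (by fun_prop)
        (f' := fun v => v * Real.exp v + 1 - Real.exp v) (fun v _ => ?_) fun v hv => ?_
      · refine HasDerivAt.hasDerivWithinAt ?_
        convert! ((hasDerivAt_id v).mul ((Real.hasDerivAt_exp v).add_const 1)).sub
          (((Real.hasDerivAt_exp v).sub_const 1).const_mul 2) using 1
        simp only [id]
        ring
      · have h := Real.add_one_le_exp (-v)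
        have he := Real.exp_pos v
        have hm : Real.exp (-v) * Real.exp v = 1 := by rw [← Real.exp_add]; simp
        nlinarith
    intro v hv
    have := hmono (Set.mem_Ici.2 le_rfl) (Set.mem_Ici.2 hv) hv
    simpa using this
  refine convexOn_of_hasDerivWithinAt2_nonneg (convex_Ioi 0)
    (fun v hv => (h1 v hv).continuousAt.continuousWithinAt)
    (fun v hv => (h1 v (by simpa using hv)).hasDerivWithinAt)
    (fun v hv => (h2 v (by simpa using hv)).hasDerivWithinAt) fun v hv => ?_
  have hv' : 0 < v := by simpa using hv
  exact div_nonneg (mul_nonneg (Real.exp_pos v).le (h3 v hv'.le)) (pow_pos (hne v hv') 3).le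

theorem hasDerivAt_log_one_sub_exp_neg_mul {s u : ℝ} (hs : 0 < s) (hu : 0 < u) :
    HasDerivAt (fun u : ℝ => Real.log (1 - Real.exp (-(u * s))))
      (u * s / (Real.exp (u * s) - 1) / u) u := by
  have hus : 0 < u * s := mul_pos hu hs
  have h1 : Real.exp (-(u * s)) < 1 := by rw [Real.exp_lt_one_iff]; linarith
  have h2 : 0 < Real.exp (u * s) - 1 := by have := Real.add_one_lt_exp hus.ne'; linarith
  have hd : HasDerivAt (fun u : ℝ => 1 - Real.exp (-(u * s)))
      (-(Real.exp (-(u * s)) * (-(1 * s)))) u :=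
    (((hasDerivAt_id u).mul_const s).neg.exp).const_sub 1
  convert! hd.log (by linarith) using 1
  rw [Real.exp_neg]
  field_simp

/-- The `q`-number `(1 - q ^ s) / (1 - q)`, with value `s` at `q = 1`. -/
noncomputable def qBracket (s q : ℝ) : ℝ := dslope (fun x : ℝ => x ^ s) 1 q

theorem qBracket_one (s : ℝ) : qBracket s 1 = s := by
  have := (Real.hasDerivAt_rpow_const (x := 1) (p := s) (Or.inl one_ne_zero)).deriv
  simp [qBracket, this]

theorem qBracket_of_ne (s : ℝ) {q : ℝ} (hq : q ≠ 1) : qBracket s q = (1 - q ^ s) / (1 - q) := by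
  rw [qBracket, dslope_of_ne _ hq, slope_def_field, Real.one_rpow, ← neg_div_neg_eq]
  ring

theorem qBracket_pos {s q : ℝ} (hs : 0 < s) (hq0 : 0 < q) (hq : q ≤ 1) : 0 < qBracket s q := by
  rcases hq.lt_or_eq with h | rfl
  · rw [qBracket_of_ne s h.ne]
    have := Real.rpow_lt_one hq0.le h hs
    exact div_pos (by linarith) (by linarith)
  · rwa [qBracket_one]

theorem qBracket_one_left {q : ℝ} : qBracket 1 q = 1 := by
  rcases eq_or_ne q 1 with rfl | h
  · rw [qBracket_one]
  · rw [qBracket_of_ne _ h, Real.rpow_one, div_self (sub_ne_zero.2 h.symm)]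

theorem continuousAt_qBracket_one (s : ℝ) : ContinuousAt (qBracket s) 1 :=
  continuousAt_dslope_same.2
    (Real.hasDerivAt_rpow_const (x := 1) (p := s) (Or.inl one_ne_zero)).differentiableAt

theorem AntitoneOn.Ioc_of_continuousAt_one {f : ℝ → ℝ} (hf : ContinuousAt f 1)
    (h : AntitoneOn f (Set.Ioo 0 1)) : AntitoneOn f (Set.Ioc 0 1) := by
  intro p hp q hq hpq
  rcases hq.2.lt_or_eq with hq1 | rfl
  · exact h ⟨hp.1, hpq.trans_lt hq1⟩ ⟨hq.1, hq1⟩ hpq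
  · rcases hp.2.lt_or_eq with hp1 | rfl
    · refine le_of_tendsto (hf.tendsto.mono_left (nhdsWithin_le_nhds (s := Set.Iio 1))) ?_
      filter_upwards [Ioo_mem_nhdsLT hp1] with r hr
      exact h ⟨hp.1, hp1⟩ ⟨hp.1.trans hr.1, hr.2⟩ hr.1.le
    · exact le_rfl

/-- The bracket is the slope from `1` of the concave function `x ^ s`. -/
theorem antitoneOn_qBracket {s : ℝ} (hs0 : 0 ≤ s) (hs : s ≤ 1) :
    AntitoneOn (qBracket s) (Set.Ioc 0 1) := by
  refine AntitoneOn.Ioc_of_continuousAt_one (continuousAt_qBracket_one s) fun p hp q hq hpq => ?_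
  have h := (Real.concaveOn_rpow hs0 hs).slope_anti (x := 1) (by simp)
  have := h (a := p) (b := q) ⟨hp.1.le, hp.2.ne⟩ ⟨hq.1.le, hq.2.ne⟩ hpq
  rwa [qBracket, qBracket, dslope_of_ne _ hp.2.ne, dslope_of_ne _ hq.2.ne]

/-- Put `q = e^(-u)`. The `log (1 - q)` terms cancel, as the weights `w`, `1 - w`, `-1` sum to zero.
The `u`-derivative of the rest is `1 / u` times the convexity gap of `v / (e^v - 1)` at `us` and
`ut`. Increasing in `u` means decreasing in `q`. -/
theorem antitoneOn_log_qBracket_interp {s t w : ℝ} (hs : 0 < s) (ht : 0 < t) (hw0 : 0 ≤ w)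
    (hw1 : w ≤ 1) :
    AntitoneOn (fun q => w * Real.log (qBracket s q) + (1 - w) * Real.log (qBracket t q)
      - Real.log (qBracket (w * s + (1 - w) * t) q)) (Set.Ioc 0 1) := by
  set r := w * s + (1 - w) * t with hr
  have hr0 : 0 < r := by
    rcases hw0.eq_or_lt with rfl | h
    · simpa [hr] using ht
    · have : 0 ≤ (1 - w) * t := mul_nonneg (by linarith) ht.le
      have := mul_pos h hs
      linarith
  have hcont : ∀ a : ℝ, 0 < a → ContinuousAt (fun q => Real.log (qBracket a q)) 1 := fun a ha =>
    (continuousAt_qBracket_one a).log (by rw [qBracket_one]; exact ha.ne')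
  refine AntitoneOn.Ioc_of_continuousAt_one
    ((((hcont s hs).const_mul w).add ((hcont t ht).const_mul (1 - w))).sub (hcont r hr0)) ?_
  have hmono : MonotoneOn (fun u : ℝ => w * Real.log (1 - Real.exp (-(u * s)))
      + (1 - w) * Real.log (1 - Real.exp (-(u * t))) - Real.log (1 - Real.exp (-(u * r))))
      (Set.Ioi 0) := by
    have hd : ∀ u : ℝ, 0 < u → HasDerivAt (fun u : ℝ => w * Real.log (1 - Real.exp (-(u * s)))
        + (1 - w) * Real.log (1 - Real.exp (-(u * t))) - Real.log (1 - Real.exp (-(u * r))))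
        (w * (u * s / (Real.exp (u * s) - 1) / u)
          + (1 - w) * (u * t / (Real.exp (u * t) - 1) / u)
          - u * r / (Real.exp (u * r) - 1) / u) u := fun u hu =>
      (((hasDerivAt_log_one_sub_exp_neg_mul hs hu).const_mul w).add
        ((hasDerivAt_log_one_sub_exp_neg_mul ht hu).const_mul (1 - w))).sub
        (hasDerivAt_log_one_sub_exp_neg_mul hr0 hu)
    refine monotoneOn_of_hasDerivWithinAt_nonneg (convex_Ioi 0)
      (fun u hu => (hd u hu).continuousAt.continuousWithinAt)
      (fun u hu => (hd u (by simpa using hu)).hasDerivWithinAt) fun u hu => ?_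
    have hu' : 0 < u := by simpa using hu
    have hc := convexOn_div_exp_sub_one.2 (Set.mem_Ioi.2 (mul_pos hu' hs))
      (Set.mem_Ioi.2 (mul_pos hu' ht)) hw0 (sub_nonneg.2 hw1) (by ring)
    simp only [smul_eq_mul] at hc
    have hur : w * (u * s) + (1 - w) * (u * t) = u * r := by rw [hr]; ring
    rw [hur] at hc
    have := div_le_div_of_nonneg_right hc hu'.le
    rw [add_div, mul_div_assoc w, mul_div_assoc (1 - w)] at this
    linarith
  have hlog : ∀ q ∈ Set.Ioo (0 : ℝ) 1, ∀ a : ℝ, 0 < a → Real.log (qBracket a q)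
      = Real.log (1 - Real.exp (-(-Real.log q * a))) - Real.log (1 - q) := fun q hq a ha => by
    rw [qBracket_of_ne a hq.2.ne, Real.log_div, Real.rpow_def_of_pos hq.1]
    · congr 4; ring
    · have := Real.rpow_lt_one hq.1.le hq.2 ha
      linarith
    · linarith [hq.2]
  intro p hp q hq hpq
  have := hmono (a := -Real.log q) (b := -Real.log p)
    (Set.mem_Ioi.2 (neg_pos.2 (Real.log_neg hq.1 hq.2)))
    (Set.mem_Ioi.2 (neg_pos.2 (Real.log_neg hp.1 hp.2)))
    (neg_le_neg (Real.log_le_log hp.1 hpq))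
  simp only [hlog p hp s hs, hlog p hp t ht, hlog p hp r hr0, hlog q hq s hs, hlog q hq t ht,
    hlog q hq r hr0]
  linarith

theorem antitoneOn_qBracket_interp {s t w : ℝ} (hs : 0 < s) (ht : 0 < t) (hw0 : 0 ≤ w)
    (hw1 : w ≤ 1) :
    AntitoneOn (fun q => qBracket s q ^ w * qBracket t q ^ (1 - w)
      / qBracket (w * s + (1 - w) * t) q) (Set.Ioc 0 1) := by
  have hr0 : 0 < w * s + (1 - w) * t := by
    rcases hw0.eq_or_lt with rfl | h
    · simpa using ht
    · have : 0 ≤ (1 - w) * t := mul_nonneg (by linarith) ht.le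
      have := mul_pos h hs
      linarith
  have hexp : ∀ q ∈ Set.Ioc (0 : ℝ) 1, qBracket s q ^ w * qBracket t q ^ (1 - w)
      / qBracket (w * s + (1 - w) * t) q = Real.exp (w * Real.log (qBracket s q)
        + (1 - w) * Real.log (qBracket t q)
        - Real.log (qBracket (w * s + (1 - w) * t) q)) := fun q hq => by
    rw [Real.exp_sub, Real.exp_add, Real.exp_log (qBracket_pos hr0 hq.1 hq.2),
      Real.rpow_def_of_pos (qBracket_pos hs hq.1 hq.2),
      Real.rpow_def_of_pos (qBracket_pos ht hq.1 hq.2), mul_comm w (Real.log _),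
      mul_comm (1 - w) (Real.log _)]
  intro p hp q hq hpq
  simp only [hexp p hp, hexp q hq]
  exact Real.exp_le_exp.2 (antitoneOn_log_qBracket_interp hs ht hw0 hw1 hp hq hpq)

/-! ### The `q`-Gamma function and its Euler approximations -/

/-- Jackson's `q`-analogue of the Gamma function. -/
noncomputable def qGamma (q x : ℝ) : ℝ :=
  qShiftedInf q q / qShiftedInf (q ^ x) q * (1 - q) ^ (1 - x)

/-- A `q`-analogue of Euler's approximation to `Γ(1 + x)`. -/
noncomputable def qGammaAddOneSeq (q x : ℝ) (N : ℕ) : ℝ :=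
  (∏ k ∈ Finset.range N, qBracket (k + 1) q / qBracket (k + 1 + x) q) * qBracket (N + 1) q ^ x

/-- A `q`-analogue of Euler's approximation to `Γ(x)`. -/
noncomputable def qGammaSeq (q x : ℝ) (N : ℕ) : ℝ :=
  (∏ k ∈ Finset.range N, qBracket (k + 1) q / qBracket (k + x) q) * qBracket (N + x) q ^ (x - 1)

theorem qGammaAddOneSeq_pos {q x : ℝ} (hq0 : 0 < q) (hq : q ≤ 1) (hx : 0 ≤ x) (N : ℕ) :
    0 < qGammaAddOneSeq q x N :=
  mul_pos (Finset.prod_pos fun k _ => div_pos (qBracket_pos (by positivity) hq0 hq)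
    (qBracket_pos (by positivity) hq0 hq))
    (Real.rpow_pos_of_pos (qBracket_pos (by positivity) hq0 hq) _)

theorem qGammaSeq_pos {q x : ℝ} (hq0 : 0 < q) (hq : q ≤ 1) (hx : 0 < x) (N : ℕ) :
    0 < qGammaSeq q x N :=
  mul_pos (Finset.prod_pos fun k _ => div_pos (qBracket_pos (by positivity) hq0 hq)
    (qBracket_pos (by positivity) hq0 hq))
    (Real.rpow_pos_of_pos (qBracket_pos (by positivity) hq0 hq) _)

/-- Consecutive terms have as ratio the interpolation quotient for `N + 2` and `N + 1` with weight
`x`, whose mean is `N + 1 + x`. The initial term is `1`. -/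
theorem antitoneOn_qGammaAddOneSeq {x : ℝ} (hx0 : 0 ≤ x) (hx1 : x ≤ 1) (N : ℕ) :
    AntitoneOn (fun q => qGammaAddOneSeq q x N) (Set.Ioc 0 1) := by
  induction N with
  | zero => intro p _ q _ _; simp [qGammaAddOneSeq, qBracket_one_left]
  | succ N ih =>
    have hR := antitoneOn_qBracket_interp (s := (N : ℝ) + 2) (t := (N : ℝ) + 1)
      (by positivity) (by positivity) hx0 hx1
    have hstep : ∀ q ∈ Set.Ioc (0 : ℝ) 1, qGammaAddOneSeq q x (N + 1) = qGammaAddOneSeq q x N *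
        (qBracket ((N : ℝ) + 2) q ^ x * qBracket ((N : ℝ) + 1) q ^ (1 - x)
          / qBracket (x * ((N : ℝ) + 2) + (1 - x) * ((N : ℝ) + 1)) q) := fun q hq => by
      have h1 : 0 < qBracket ((N : ℝ) + 1) q := qBracket_pos (by positivity) hq.1 hq.2
      have h2 : 0 < qBracket ((N : ℝ) + 1) q ^ x := Real.rpow_pos_of_pos h1 _
      have e1 : x * ((N : ℝ) + 2) + (1 - x) * ((N : ℝ) + 1) = N + 1 + x := by ring
      have e2 : ((N + 1 : ℕ) : ℝ) + 1 = N + 2 := by push_cast; ring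
      rw [qGammaAddOneSeq, qGammaAddOneSeq, Finset.prod_range_succ, e1, e2, Real.rpow_sub h1,
        Real.rpow_one]
      field_simp
    intro p hp q hq hpq
    simp only [hstep p hp, hstep q hq]
    refine mul_le_mul (ih hp hq hpq) (hR hp hq hpq) ?_
      (qGammaAddOneSeq_pos hp.1 hp.2 hx0 N).le
    have h1 : 0 < qBracket ((N : ℝ) + 1) q := qBracket_pos (by positivity) hq.1 hq.2
    have h2 : 0 < qBracket ((N : ℝ) + 2) q := qBracket_pos (by positivity) hq.1 hq.2
    have h3 : 0 < qBracket (x * ((N : ℝ) + 2) + (1 - x) * ((N : ℝ) + 1)) q :=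
      qBracket_pos (by nlinarith [N.cast_nonneg (α := ℝ)]) hq.1 hq.2
    positivity

/-- The ratio is now the reciprocal of the interpolation quotient for `N + x` and `N + 1 + x`, whose
mean is `N + 1`, so the direction reverses. The initial term `[x]^(x-1)` is a nonpositive power of
an antitone bracket. -/
theorem monotoneOn_qGammaSeq {x : ℝ} (hx0 : 0 < x) (hx1 : x ≤ 1) (N : ℕ) :
    MonotoneOn (fun q => qGammaSeq q x N) (Set.Ioc 0 1) := by
  induction N with
  | zero =>
    intro p hp q hq hpq
    simp only [qGammaSeq, Finset.range_zero, Finset.prod_empty, one_mul, Nat.cast_zero, zero_add]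
    exact Real.rpow_le_rpow_of_nonpos (qBracket_pos hx0 hq.1 hq.2)
      (antitoneOn_qBracket hx0.le hx1 hp hq hpq) (by linarith)
  | succ N ih =>
    have hR := antitoneOn_qBracket_interp (s := (N : ℝ) + x) (t := (N : ℝ) + 1 + x)
      (by positivity) (by positivity) hx0.le hx1
    have e1 : x * ((N : ℝ) + x) + (1 - x) * ((N : ℝ) + 1 + x) = N + 1 := by ring
    rw [e1] at hR
    have hR0 : ∀ q ∈ Set.Ioc (0 : ℝ) 1, 0 < qBracket ((N : ℝ) + x) q ^ x
        * qBracket ((N : ℝ) + 1 + x) q ^ (1 - x) / qBracket ((N : ℝ) + 1) q := fun q hq => by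
      have h1 : 0 < qBracket ((N : ℝ) + 1) q := qBracket_pos (by positivity) hq.1 hq.2
      have h2 : 0 < qBracket ((N : ℝ) + x) q := qBracket_pos (by positivity) hq.1 hq.2
      have h3 : 0 < qBracket ((N : ℝ) + 1 + x) q := qBracket_pos (by positivity) hq.1 hq.2
      positivity
    have hstep : ∀ q ∈ Set.Ioc (0 : ℝ) 1, qGammaSeq q x (N + 1) = qGammaSeq q x N /
        (qBracket ((N : ℝ) + x) q ^ x * qBracket ((N : ℝ) + 1 + x) q ^ (1 - x)
          / qBracket ((N : ℝ) + 1) q) := fun q hq => by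
      have h1 : 0 < qBracket ((N : ℝ) + 1) q := qBracket_pos (by positivity) hq.1 hq.2
      have h2 : 0 < qBracket ((N : ℝ) + x) q := qBracket_pos (by positivity) hq.1 hq.2
      have h3 : 0 < qBracket ((N : ℝ) + 1 + x) q := qBracket_pos (by positivity) hq.1 hq.2
      have h4 := Real.rpow_pos_of_pos h2 x
      have h5 := Real.rpow_pos_of_pos h3 x
      have e2 : ((N + 1 : ℕ) : ℝ) + x = N + 1 + x := by push_cast; ring
      rw [qGammaSeq, qGammaSeq, Finset.prod_range_succ, e2, Real.rpow_sub h3, Real.rpow_sub h3,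
        Real.rpow_sub h2, Real.rpow_one, Real.rpow_one]
      field_simp
    intro p hp q hq hpq
    simp only [hstep p hp, hstep q hq]
    exact div_le_div₀ (qGammaSeq_pos hq.1 hq.2 hx0 N).le (ih hp hq hpq) (hR0 q hq)
      (hR hp hq hpq)

theorem prod_qBracket_div {q : ℝ} (hq0 : 0 < q) (hq : q < 1) (x : ℝ) (N : ℕ) :
    ∏ k ∈ Finset.range N, qBracket (k + 1) q / qBracket (k + x) q
      = qShifted q q N / qShifted (q ^ x) q N := by
  rw [qShifted, qShifted, ← Finset.prod_div_distrib]
  refine Finset.prod_congr rfl fun k _ => ?_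
  have h1 : 1 - q ≠ 0 := by linarith
  rw [qBracket_of_ne _ hq.ne, qBracket_of_ne _ hq.ne, div_div_div_cancel_right₀ h1,
    Real.rpow_add hq0, Real.rpow_add hq0, Real.rpow_natCast, Real.rpow_one, mul_comm q,
    mul_comm (q ^ x)]

theorem tendsto_qBracket_add {q : ℝ} (hq0 : 0 < q) (hq : q < 1) (x : ℝ) :
    Tendsto (fun N : ℕ => qBracket (N + x) q) atTop (𝓝 (1 - q)⁻¹) := by
  have h : Tendsto (fun N : ℕ => (1 - q ^ N * q ^ x) / (1 - q)) atTop
      (𝓝 ((1 - 0 * q ^ x) / (1 - q))) :=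
    (((tendsto_pow_atTop_nhds_zero_of_lt_one hq0.le hq).mul_const _).const_sub 1).div_const _
  rw [zero_mul, sub_zero, one_div] at h
  refine h.congr fun N => ?_
  rw [qBracket_of_ne _ hq.ne, Real.rpow_add hq0, Real.rpow_natCast]

theorem tendsto_qGammaSeq {q x : ℝ} (hq0 : 0 < q) (hq : q < 1) (hx : 0 < x) :
    Tendsto (qGammaSeq q x) atTop (𝓝 (qGamma q x)) := by
  have hqn : ‖q‖ < 1 := by rwa [Real.norm_of_nonneg hq0.le]
  have h1 : 0 < 1 - q := by linarith
  have h := ((tendsto_qShifted q q hqn).div (tendsto_qShifted (q ^ x) q hqn)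
    (qShiftedInf_pos (Real.rpow_nonneg hq0.le x) (Real.rpow_lt_one hq0.le hq hx) hq0.le hq).ne').mul
    ((tendsto_qBracket_add hq0 hq x).rpow_const (p := x - 1) (Or.inl (inv_pos.2 h1).ne'))
  rw [Real.inv_rpow h1.le, ← Real.rpow_neg h1.le, neg_sub] at h
  refine h.congr fun N => ?_
  rw [qGammaSeq, prod_qBracket_div hq0 hq]
  rfl

theorem tendsto_qGammaAddOneSeq {q x : ℝ} (hq0 : 0 < q) (hq : q < 1) (hx : 0 ≤ x) :
    Tendsto (qGammaAddOneSeq q x) atTop (𝓝 (qGamma q (1 + x))) := by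
  have hqn : ‖q‖ < 1 := by rwa [Real.norm_of_nonneg hq0.le]
  have h1 : 0 < 1 - q := by linarith
  have h := ((tendsto_qShifted q q hqn).div (tendsto_qShifted (q ^ (1 + x)) q hqn)
    (qShiftedInf_pos (Real.rpow_nonneg hq0.le _) (Real.rpow_lt_one hq0.le hq (by positivity))
      hq0.le hq).ne').mul
    ((tendsto_qBracket_add hq0 hq 1).rpow_const (p := x) (Or.inl (inv_pos.2 h1).ne'))
  rw [Real.inv_rpow h1.le, ← Real.rpow_neg h1.le, show -x = 1 - (1 + x) by ring] at h
  refine h.congr fun N => ?_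
  simp only [qGammaAddOneSeq, add_assoc, prod_qBracket_div hq0 hq]
  rfl

theorem qGammaSeq_one {x : ℝ} (hx : 0 < x) {N : ℕ} (hN : N ≠ 0) :
    qGammaSeq 1 x N = Real.GammaSeq x N * (1 + x / N) ^ x := by
  have hN' : (0 : ℝ) < N := by positivity
  have hP : 0 < ∏ k ∈ Finset.range N, (x + (k : ℝ)) := Finset.prod_pos fun k _ => by positivity
  have h1 : (1 + x / N) ^ x = (N + x) ^ x / (N : ℝ) ^ x := by
    rw [← Real.div_rpow (by positivity) hN'.le]; congr 1; field_simp
  have h2 : ((N.factorial : ℕ) : ℝ) = ∏ k ∈ Finset.range N, ((k : ℝ) + 1) := by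
    rw [← Finset.prod_range_add_one_eq_factorial]; push_cast; rfl
  have h3 : 0 < (N : ℝ) ^ x := Real.rpow_pos_of_pos hN' x
  have h4 : 0 < (N : ℝ) + x := by positivity
  rw [qGammaSeq, Real.GammaSeq, h1, h2, Finset.prod_range_succ]
  simp only [qBracket_one, Finset.prod_div_distrib]
  rw [Real.rpow_sub h4, Real.rpow_one, add_comm x (N : ℝ)]
  simp only [add_comm x]
  simp only [add_comm x] at hP
  field_simp

theorem tendsto_one_add_div_rpow (c x : ℝ) :
    Tendsto (fun N : ℕ => (1 + c / (N : ℝ)) ^ x) atTop (𝓝 1) := by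
  have h := ((tendsto_const_div_atTop_nhds_zero_nat c).const_add 1).rpow_const (p := x)
    (Or.inl (by norm_num))
  simpa using h

theorem tendsto_qGammaSeq_one {x : ℝ} (hx : 0 < x) :
    Tendsto (qGammaSeq 1 x) atTop (𝓝 (Real.Gamma x)) := by
  have h := (Real.GammaSeq_tendsto_Gamma x).mul (tendsto_one_add_div_rpow x x)
  rw [mul_one] at h
  refine h.congr' ?_
  filter_upwards [eventually_ne_atTop 0] with N hN
  exact (qGammaSeq_one hx hN).symm

theorem qGammaAddOneSeq_one {x : ℝ} (hx : 0 < x) {N : ℕ} (hN : N ≠ 0) :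
    qGammaAddOneSeq 1 x N = x * Real.GammaSeq x N * (1 + 1 / N) ^ x := by
  have hN' : (0 : ℝ) < N := by positivity
  have hP : 0 < ∏ k ∈ Finset.range N, ((k : ℝ) + 1 + x) := Finset.prod_pos fun k _ => by positivity
  have h1 : (1 + 1 / (N : ℝ)) ^ x = (N + 1) ^ x / (N : ℝ) ^ x := by
    rw [← Real.div_rpow (by positivity) hN'.le]; congr 1; field_simp
  have h2 : ((N.factorial : ℕ) : ℝ) = ∏ k ∈ Finset.range N, ((k : ℝ) + 1) := by
    rw [← Finset.prod_range_add_one_eq_factorial]; push_cast; rfl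
  have h3 : 0 < (N : ℝ) ^ x := Real.rpow_pos_of_pos hN' x
  have h4 : ∏ k ∈ Finset.range N, (x + ((k + 1 : ℕ) : ℝ))
      = ∏ k ∈ Finset.range N, ((k : ℝ) + 1 + x) :=
    Finset.prod_congr rfl fun k _ => by push_cast; ring
  -- Splitting off the first factor of the denominator of `GammaSeq` isolates an `x` that cancels
  -- the leading one.
  rw [qGammaAddOneSeq, Real.GammaSeq, h1, h2, Finset.prod_range_succ', h4]
  simp only [qBracket_one, Finset.prod_div_distrib, Nat.cast_zero, add_zero]
  field_simp

theorem tendsto_qGammaAddOneSeq_one {x : ℝ} (hx : 0 < x) :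
    Tendsto (qGammaAddOneSeq 1 x) atTop (𝓝 (x * Real.Gamma x)) := by
  have h := ((Real.GammaSeq_tendsto_Gamma x).const_mul x).mul (tendsto_one_add_div_rpow 1 x)
  rw [mul_one] at h
  refine h.congr' ?_
  filter_upwards [eventually_ne_atTop 0] with N hN
  exact (qGammaAddOneSeq_one hx hN).symm

theorem qGamma_pos {q x : ℝ} (hq0 : 0 < q) (hq : q < 1) (hx : 0 < x) : 0 < qGamma q x :=
  mul_pos (div_pos (qShiftedInf_pos hq0.le hq hq0.le hq)
    (qShiftedInf_pos (Real.rpow_nonneg hq0.le x) (Real.rpow_lt_one hq0.le hq hx) hq0.le hq))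
    (Real.rpow_pos_of_pos (by linarith) _)

theorem qGamma_le_qGamma {p q x : ℝ} (hp : 0 < p) (hpq : p ≤ q) (hq : q < 1) (hx0 : 0 < x)
    (hx1 : x ≤ 1) : qGamma p x ≤ qGamma q x :=
  le_of_tendsto_of_tendsto' (tendsto_qGammaSeq hp (hpq.trans_lt hq) hx0)
    (tendsto_qGammaSeq (hp.trans_le hpq) hq hx0) fun N =>
    monotoneOn_qGammaSeq hx0 hx1 N ⟨hp, (hpq.trans_lt hq).le⟩ ⟨hp.trans_le hpq, hq.le⟩ hpq

/-- The `N`-th approximations at `q` and at `1` are compared before `N → ∞`. -/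
theorem qGamma_le_Gamma {q x : ℝ} (hq0 : 0 < q) (hq : q < 1) (hx0 : 0 < x)
    (hx1 : x ≤ 1) : qGamma q x ≤ Real.Gamma x :=
  le_of_tendsto_of_tendsto' (tendsto_qGammaSeq hq0 hq hx0) (tendsto_qGammaSeq_one hx0) fun N =>
    monotoneOn_qGammaSeq hx0 hx1 N ⟨hq0, hq.le⟩ ⟨one_pos, le_rfl⟩ hq.le

theorem qGamma_one_add_le_qGamma_one_add {p q x : ℝ} (hp : 0 < p) (hpq : p ≤ q) (hq : q < 1)
    (hx0 : 0 ≤ x) (hx1 : x ≤ 1) : qGamma q (1 + x) ≤ qGamma p (1 + x) :=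
  le_of_tendsto_of_tendsto' (tendsto_qGammaAddOneSeq (hp.trans_le hpq) hq hx0)
    (tendsto_qGammaAddOneSeq hp (hpq.trans_lt hq) hx0) fun N =>
    antitoneOn_qGammaAddOneSeq hx0 hx1 N ⟨hp, (hpq.trans_lt hq).le⟩ ⟨hp.trans_le hpq, hq.le⟩ hpq

theorem mul_Gamma_le_qGamma_one_add {q x : ℝ} (hq0 : 0 < q) (hq : q < 1) (hx0 : 0 < x)
    (hx1 : x ≤ 1) : x * Real.Gamma x ≤ qGamma q (1 + x) :=
  le_of_tendsto_of_tendsto' (tendsto_qGammaAddOneSeq_one hx0)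
    (tendsto_qGammaAddOneSeq hq0 hq hx0.le) fun N =>
    antitoneOn_qGammaAddOneSeq hx0.le hx1 N ⟨hq0, hq.le⟩ ⟨one_pos, le_rfl⟩ hq.le

/-! ### Products over the fractions `k / n`, and the theorem -/

theorem sum_range_add_one_div (m : ℕ) :
    ∑ k ∈ Finset.range m, ((k : ℝ) + 1) / (m + 1) = m / 2 := by
  have h : ∀ j : ℕ, ∑ k ∈ Finset.range j, ((k : ℝ) + 1) = j * (j + 1) / 2 := fun j => by
    induction j with
    | zero => simp
    | succ j ih => rw [Finset.sum_range_succ, ih]; push_cast; ring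
  rw [← Finset.sum_div, h]
  field_simp

-- With base `q^(1/n)`, the last residue class contributes `(q; q)_∞`, cancelling one of the `n`
-- powers. The exponents `1 - k/n` of `1 - q` add up to `(n - 1) / 2`.
open Finset in
theorem prod_qGamma_div {q : ℝ} (hq0 : 0 < q) (hq : q < 1) (m : ℕ) :
    qShiftedInf q q ^ (m + 1)
        / qShiftedInf (q ^ (1 / ((m : ℝ) + 1))) (q ^ (1 / ((m : ℝ) + 1))) * (1 - q) ^ ((m : ℝ) / 2)
      = ∏ k ∈ range m, qGamma q (((k : ℝ) + 1) / (m + 1)) := by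
  have hr : q ^ (1 / ((m : ℝ) + 1)) < 1 := Real.rpow_lt_one hq0.le hq (by positivity)
  have hr0 : 0 < q ^ (1 / ((m : ℝ) + 1)) := Real.rpow_pos_of_pos hq0 _
  have hpow : ∀ k : ℕ, (q ^ (1 / ((m : ℝ) + 1))) ^ (k + 1) = q ^ (((k : ℝ) + 1) / (m + 1)) :=
    fun k => by
    rw [← Real.rpow_natCast, ← Real.rpow_mul hq0.le]; congr 1; push_cast; ring
  have hlast : q ^ (((m : ℝ) + 1) / (m + 1)) = q := by
    rw [div_self (by positivity), Real.rpow_one]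
  have hexp : (m : ℝ) / 2 = ∑ k ∈ range m, (1 - ((k : ℝ) + 1) / (m + 1)) := by
    rw [sum_sub_distrib, sum_range_add_one_div]; simp; ring
  have hpos := qShiftedInf_pos hq0.le hq hq0.le hq
  rw [qShiftedInf_eq_prod (q ^ (1 / ((m : ℝ) + 1))) _ (by rwa [Real.norm_of_nonneg hr0.le])
    m.succ_ne_zero, hexp, Real.rpow_sum_of_pos (by linarith)]
  simp only [← pow_succ', hpow, prod_range_succ, hlast, qGamma, prod_mul_distrib,
    prod_div_distrib, prod_const, card_range, Nat.succ_eq_add_one]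
  rw [pow_succ]
  field_simp

open Finset in
theorem prod_qGamma_one_add_div {q : ℝ} (hq0 : 0 < q) (hq : q < 1) (m : ℕ) :
    qShiftedInf q q ^ (m + 1) / qShiftedInf q (q ^ (1 / ((m : ℝ) + 1)))
        * (1 / (1 - q) ^ ((m : ℝ) / 2))
      = ∏ k ∈ range m, qGamma q (1 + ((k : ℝ) + 1) / (m + 1)) := by
  have hr : q ^ (1 / ((m : ℝ) + 1)) < 1 := Real.rpow_lt_one hq0.le hq (by positivity)
  have hr0 : 0 < q ^ (1 / ((m : ℝ) + 1)) := Real.rpow_pos_of_pos hq0 _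
  have h1 : 0 < 1 - q := by linarith
  have hpow : ∀ k : ℕ, (q ^ (1 / ((m : ℝ) + 1))) ^ (k + 1) = q ^ (((k : ℝ) + 1) / (m + 1)) :=
    fun k => by
    rw [← Real.rpow_natCast, ← Real.rpow_mul hq0.le]; congr 1; push_cast; ring
  have hlast : q ^ (((m : ℝ) + 1) / (m + 1)) = q := by
    rw [div_self (by positivity), Real.rpow_one]
  have hexp : -((m : ℝ) / 2) = ∑ k ∈ range m, (1 - (1 + ((k : ℝ) + 1) / (m + 1))) := by
    simp only [sub_add_cancel_left, sum_neg_distrib, sum_range_add_one_div]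
  have hpos := qShiftedInf_pos hq0.le hq hq0.le hq
  rw [qShiftedInf_eq_prod q (q ^ (1 / ((m : ℝ) + 1))) (by rwa [Real.norm_of_nonneg hr0.le])
    m.succ_ne_zero, one_div ((1 - q) ^ ((m : ℝ) / 2)), ← Real.rpow_neg h1.le, hexp,
    Real.rpow_sum_of_pos h1]
  simp only [hpow, Nat.succ_eq_add_one, hlast]
  -- Here the first class, not the last, is `(q; q)_∞`.
  rw [prod_range_succ']
  simp only [hpow, Real.rpow_add hq0, Real.rpow_one, qGamma, prod_mul_distrib,
    prod_div_distrib, prod_const, card_range, pow_zero, mul_one]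
  rw [pow_succ]
  field_simp

open Finset in
theorem prod_div_mul_Gamma_eq (m : ℕ) :
    ∏ k ∈ range m, (((k : ℝ) + 1) / (m + 1) * Real.Gamma (((k : ℝ) + 1) / (m + 1)))
      = (m.factorial : ℝ) * (2 * Real.pi) ^ ((m : ℝ) / 2)
        / ((m : ℝ) + 1) ^ ((m : ℝ) + 1 - 1 / 2) := by
  have hm : (0 : ℝ) < m + 1 := by positivity
  have hf : ((m.factorial : ℕ) : ℝ) = ∏ k ∈ range m, ((k : ℝ) + 1) := by
    rw [← prod_range_add_one_eq_factorial]; push_cast; rfl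
  have he : ((m : ℝ) + 1) ^ ((m : ℝ) + 1 - 1 / 2) = ((m : ℝ) + 1) ^ m * Real.sqrt (m + 1) := by
    rw [Real.sqrt_eq_rpow, ← Real.rpow_natCast, ← Real.rpow_add hm]; congr 1; ring
  rw [prod_mul_distrib, prod_Gamma_div_eq, prod_div_distrib, prod_const, card_range, hf, he]
  field_simp

theorem mainTheorem6 (p q : ℝ) (hp : 0 < p) (hpq : p < q) (hq : q < 1) (n : ℕ) (hn : 1 < n) :
    ((qShiftedInf p p ^ n / qShiftedInf (p ^ (1 / (n : ℝ))) (p ^ (1 / (n : ℝ)))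
          * (1 - p) ^ (((n : ℝ) - 1) / 2)
        ≤ qShiftedInf q q ^ n / qShiftedInf (q ^ (1 / (n : ℝ))) (q ^ (1 / (n : ℝ)))
          * (1 - q) ^ (((n : ℝ) - 1) / 2)) ∧
      (qShiftedInf q q ^ n / qShiftedInf (q ^ (1 / (n : ℝ))) (q ^ (1 / (n : ℝ)))
          * (1 - q) ^ (((n : ℝ) - 1) / 2)
        ≤ (2 * Real.pi) ^ (((n : ℝ) - 1) / 2) / Real.sqrt (n : ℝ))) ∧
    ((qShiftedInf p p ^ n / qShiftedInf p (p ^ (1 / (n : ℝ)))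
          * (1 / (1 - p) ^ (((n : ℝ) - 1) / 2))
        ≥ qShiftedInf q q ^ n / qShiftedInf q (q ^ (1 / (n : ℝ)))
          * (1 / (1 - q) ^ (((n : ℝ) - 1) / 2))) ∧
      (qShiftedInf q q ^ n / qShiftedInf q (q ^ (1 / (n : ℝ)))
          * (1 / (1 - q) ^ (((n : ℝ) - 1) / 2))
        ≥ (Nat.factorial (n - 1) : ℝ) * (2 * Real.pi) ^ (((n : ℝ) - 1) / 2)
          / (n : ℝ) ^ ((n : ℝ) - 1 / 2))) := by
  obtain ⟨m, rfl⟩ : ∃ m, n = m + 1 := ⟨n - 1, by omega⟩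
  have hq0 := hp.trans hpq
  have hp1 := hpq.trans hq
  have hx0 : ∀ k : ℕ, 0 < ((k : ℝ) + 1) / (m + 1) := fun k => by positivity
  have hx1 : ∀ k ∈ Finset.range m, ((k : ℝ) + 1) / (m + 1) ≤ 1 := fun k hk => by
    have : (k : ℝ) ≤ m := by exact_mod_cast (Finset.mem_range.1 hk).le
    rw [div_le_one (by positivity)]
    linarith
  simp only [Nat.cast_add, Nat.cast_one, add_sub_cancel_right, Nat.add_sub_cancel, ge_iff_le]
  rw [prod_qGamma_div hp hp1, prod_qGamma_div hq0 hq, prod_qGamma_one_add_div hp hp1,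
    prod_qGamma_one_add_div hq0 hq, ← prod_Gamma_div_eq, ← prod_div_mul_Gamma_eq]
  refine ⟨⟨?_, ?_⟩, ?_, ?_⟩
  · exact Finset.prod_le_prod (fun k _ => (qGamma_pos hp hp1 (hx0 k)).le) fun k hk =>
      qGamma_le_qGamma hp hpq.le hq (hx0 k) (hx1 k hk)
  · exact Finset.prod_le_prod (fun k _ => (qGamma_pos hq0 hq (hx0 k)).le) fun k hk =>
      qGamma_le_Gamma hq0 hq (hx0 k) (hx1 k hk)
  · exact Finset.prod_le_prod
      (fun k _ => (qGamma_pos hq0 hq (add_pos one_pos (hx0 k))).le) fun k hk =>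
      qGamma_one_add_le_qGamma_one_add hp hpq.le hq (hx0 k).le (hx1 k hk)
  · exact Finset.prod_le_prod
      (fun k _ => (mul_pos (hx0 k) (Real.Gamma_pos_of_pos (hx0 k))).le) fun k hk =>
      mul_Gamma_le_qGamma_one_add hq0 hq (hx0 k) (hx1 k hk)
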